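/- \textbf{Setting.} Let $\mathbf Y=\mathbf X\beta^0+\varepsilon$ with a fixed $n\times p$ design matrix $\mathbf X$, $\beta^0\in\mathbb R^p$ and $\varepsilon\sim\mathcal N_n(0,\sigma^2 I)$, $\sigma>0$. Let $S_0=\{j:\beta^0_j\ne0\}$, and for $C\subseteq\{1,\dots,p\}$ let $H_{0,C}$ be the hypothesis that $\beta^0_j=0$ for all $j\in C$. Let $\mathcal T$ be a fixed hierarchy, that is, a set of subsets (clusters) of $\{1,\dots,p\}$ which contains $\{1,\dots,p\}$ and any two of which are nested or disjoint, and let $\mathcal T_0=\{C\in\mathcal T: H_{0,C}\text{ is true}\}$. For $b=1,\dots,B$ (with $B\ge1$) split $\{1,\dots,n\}=N_{in}^{(b)}\sqcup N_{out}^{(b)}$ at random with $|N_{in}^{(b)}|=\lfloor n/2\rfloor$, and let $\hat S^{(b)}\subseteq\{1,\dots,p\}$ be the set of variables which a (measurable, possibly randomized) screening procedure $\hat S$ selects using only the observations in $N_{in}^{(b)}$. The splits, together with the internal randomness of the screening procedure (if any), are independent and identically distributed over $b$ and independent of $\varepsilon$. Assume that almost surely, for every $b$, the matrix $\mathbf X_{N_{out}^{(b)},\hat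 S^{(b)}}$ has full column rank. For $C\in\mathcal T$ with $C\cap\hat S^{(b)}\neq\emptyset$ let $p^{C,(b)}$ be the p-value of the classical partial F-test, based on the observations in $N_{out}^{(b)}$, of the hypothesis that in the linear model with variables $\hat S^{(b)}$ all coefficients of variables in $C\cap\hat S^{(b)}$ are zero, and put $p_{adj}^{C,(b)}=\min\big(p^{C,(b)}\,|\hat S^{(b)}|/|C\cap\hat S^{(b)}|,\,1\big)$; if $C\cap\hat S^{(b)}=\emptyset$ put $p_{adj}^{C,(b)}=1$. For $\gamma\in(0,1)$ and a fixed $\gamma_{\min}\in(0,1)$ define $$Q^C(\gamma)=\min\big\{1,\,q_\gamma\big(\{p_{adj}^{C,(b)}/\gamma;\ b=1,\dots,B\}\big)\big\},\qquad Q_h^C(\gamma)=\max_{D\in\mathcal T:\,C\subseteq D}Q^D(\gamma),$$ $$P^C=\min\big\{1,\,(1-\log\gamma_{\min})\inf_{\gamma\in(\gamma_{\min},1)}Q^C(\gamma)\big\},\qquad P_h^C=\max_{D\in\mathcal T:\,C\subseteq D}P^D,$$ where $q_\gamma(\{x_b\})$ is the smallest $t$ such that at least $\gamma B$ of the numbers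 $x_1,\dots,x_B$ are $\le t$ (the empirical $\gamma$-quantile). For $\alpha\in(0,1)$ let $\mathcal T_{rej}^\gamma=\{C\in\mathcal T:Q_h^C(\gamma)\le\alpha\}$ and $\mathcal T_{rej}=\{C\in\mathcal T:P_h^C\le\alpha\}$. \textbf{Theorem.} Assume (A1) $|\hat S^{(b)}|<n/2$ almost surely, and (A2) $\mathbb P[\hat S^{(b)}\supseteq S_0]\ge1-\delta$, for every $b$, where $0<\delta<1$. Then for every $\alpha\in(0,1)$: \begin{enumerate} \item For every fixed $\gamma\in(0,1)$, $\ \mathbb P(\mathcal T^\gamma_{rej}\cap\mathcal T_0\neq\emptyset)\le\alpha+1-(1-\delta)^B\le\alpha+B\delta$. \item For every fixed $\gamma_{\min}\in(0,1)$, $\ \mathbb P(\mathcal T_{rej}\cap\mathcal T_0\neq\emptyset)\le\alpha+1-(1-\delta)^B\le\alpha+B\delta$. \end{enumerate} -/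

import Mathlib

open MeasureTheory ProbabilityTheory

noncomputable section

namespace HierTest

/-! ### The linear model -/

/-- The response `Y = X β⁰ + ε` of the linear model. -/
def response {n p : ℕ} (X : Matrix (Fin n) (Fin p) ℝ) (β : Fin p → ℝ)
    (ε : EuclideanSpace ℝ (Fin n)) : Fin n → ℝ :=
  fun i => (X.mulVec β) i + ε i

/-- The active set `S₀ = {j : β⁰_j ≠ 0}`. -/
def activeSet {p : ℕ} (β : Fin p → ℝ) : Finset (Fin p) :=
  Finset.univ.filter fun j => β j ≠ 0

/-- The null hypothesis `H_{0,C}`: `β⁰_j = 0` for all `j ∈ C`. -/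
def NullHypothesis {p : ℕ} (β : Fin p → ℝ) (C : Finset (Fin p)) : Prop :=
  ∀ j ∈ C, β j = 0

/-! ### Hierarchies of clusters -/

/-- A hierarchy on `{1, …, p}`: a set of clusters that contains the root `{1, …, p}`, any two of
which are nested or disjoint. -/
structure Hierarchy (p : ℕ) where
  /-- the clusters -/
  clusters : Finset (Finset (Fin p))
  root_mem : Finset.univ ∈ clusters
  nested_or_disjoint : ∀ C ∈ clusters, ∀ D ∈ clusters, C ⊆ D ∨ D ⊆ C ∨ Disjoint C D

/-- The clusters of the hierarchy for which the null hypothesis is true. -/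
def Hierarchy.nullClusters {p : ℕ} (T : Hierarchy p) (β : Fin p → ℝ) : Set (Finset (Fin p)) :=
  {C | C ∈ T.clusters ∧ NullHypothesis β C}

/-- Hierarchical adjustment of a family of p-values `f`: the maximum of `f D` over all clusters
`D ⊇ C`. -/
def Hierarchy.adjust {p : ℕ} (T : Hierarchy p) (f : Finset (Fin p) → ℝ) (C : Finset (Fin p)) : ℝ :=
  (T.clusters.filter fun D => C ⊆ D).sup'
    ⟨Finset.univ, Finset.mem_filter.2 ⟨T.root_mem, Finset.subset_univ C⟩⟩ f

/-- The clusters that are rejected at level `α` with the p-values `h`. -/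
def Hierarchy.rejected {p : ℕ} (T : Hierarchy p) (h : Finset (Fin p) → ℝ) (α : ℝ) :
    Set (Finset (Fin p)) :=
  {C | C ∈ T.clusters ∧ h C ≤ α}

/-! ### The partial F-test -/

/-- The chi-squared distribution with `k` degrees of freedom: the law of the squared norm of a
standard Gaussian vector in `ℝ^k`. -/
def chiSquared (k : ℕ) : Measure ℝ :=
  (stdGaussian (EuclideanSpace ℝ (Fin k))).map fun z => ‖z‖ ^ 2

/-- The (central) F distribution with `k` and `l` degrees of freedom: the law of
`(U / k) / (V / l)` for independent chi-squared variables `U` and `V` with `k` and `l` degrees of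
freedom. -/
def fDistribution (k l : ℕ) : Measure ℝ :=
  ((chiSquared k).prod (chiSquared l)).map fun x => (x.1 / k) / (x.2 / l)

/-- The span in `ℝ^I` of the columns `j ∈ M` of the rows `I` of the design matrix. -/
def columnSpace {n p : ℕ} (X : Matrix (Fin n) (Fin p) ℝ) (I : Finset (Fin n))
    (M : Finset (Fin p)) : Submodule ℝ (EuclideanSpace ℝ I) :=
  Submodule.span ℝ ((fun j => WithLp.toLp 2 fun i : I => X i j) '' (M : Set (Fin p)))

/-- The residual sum of squares of the least squares regression of `Y_I` on `X_{I,M}`. -/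
def rss {n p : ℕ} (X : Matrix (Fin n) (Fin p) ℝ) (I : Finset (Fin n))
    (M : Finset (Fin p)) (y : Fin n → ℝ) : ℝ :=
  let v : EuclideanSpace ℝ I := WithLp.toLp 2 fun i : I => y i
  ‖v - (columnSpace X I M).starProjection v‖ ^ 2

/-- The partial F-statistic, computed on the observations `I`, for the hypothesis that in the full
model with variables `S` the coefficients of all variables in `C ∩ S` are zero. It compares the
full model with the model in which the variables in `C` are left out (the subtraction `#I - #S` is
in `ℕ`; it is used for `#S < #I`). -/
def fStatistic {n p : ℕ} (X : Matrix (Fin n) (Fin p) ℝ) (I : Finset (Fin n))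
    (S C : Finset (Fin p)) (y : Fin n → ℝ) : ℝ :=
  ((rss X I (S \ C) y - rss X I S y) / (C ∩ S).card) / (rss X I S y / ((I.card - S.card : ℕ) : ℝ))

/-- The p-value of the partial F-test: the upper tail of the F distribution with `#(C ∩ S)` and
`#I - #S` degrees of freedom at the value of the partial F-statistic. -/
def partialFPValue {n p : ℕ} (X : Matrix (Fin n) (Fin p) ℝ) (I : Finset (Fin n))
    (S C : Finset (Fin p)) (y : Fin n → ℝ) : ℝ :=
  (fDistribution (C ∩ S).card (I.card - S.card)).real (Set.Ici (fStatistic X I S C y))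

/-- The p-value of the cluster `C`, from the observations `I` and the screened set `S`. -/
def clusterPValue {n p : ℕ} (X : Matrix (Fin n) (Fin p) ℝ) (I : Finset (Fin n))
    (S C : Finset (Fin p)) (y : Fin n → ℝ) : ℝ :=
  if (C ∩ S).Nonempty then partialFPValue X I S C y else 1

/-- The multiplicity adjusted p-value of the cluster `C`. -/
def adjPValue {n p : ℕ} (X : Matrix (Fin n) (Fin p) ℝ) (I : Finset (Fin n))
    (S C : Finset (Fin p)) (y : Fin n → ℝ) : ℝ :=
  if (C ∩ S).Nonempty then
    min (clusterPValue X I S C y * ((S.card : ℝ) / ((C ∩ S).card : ℝ))) 1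
  else 1

/-! ### Screening and sample splitting -/

/-- A screening procedure for a fixed design matrix: from a set `I` of observations, a seed
`u` (the internal randomness of the procedure, for instance random cross-validation folds; a
deterministic procedure ignores it) and the responses `Y_I` only, it computes a set of
variables. -/
structure Screening (n p : ℕ) (U : Type*) [MeasurableSpace U] where
  /-- the selected set -/
  select : (I : Finset (Fin n)) → U → (I → ℝ) → Finset (Fin p)
  measurable_select : ∀ I : Finset (Fin n),
    Measurable fun x : U × (I → ℝ) => select I x.1 x.2

/-- The set `Ŝ` selected on the subsample `I` of the data `y`. -/
def Screening.selected {n p : ℕ} {U : Type*} [MeasurableSpace U] (A : Screening n p U)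
    (I : Finset (Fin n)) (u : U) (y : Fin n → ℝ) : Finset (Fin p) :=
  A.select I u fun i => y i

/-- The adjusted p-values `p_adj^{C,(1)}, …, p_adj^{C,(B)}` of the cluster `C`: for the `b`-th split,
screening is done on the observations `N b` and testing on the remaining ones. -/
def splitPValues {n p B : ℕ} {U : Type*} [MeasurableSpace U] (X : Matrix (Fin n) (Fin p) ℝ)
    (A : Screening n p U) (N : Fin B → Finset (Fin n)) (ξ : Fin B → U) (y : Fin n → ℝ)
    (C : Finset (Fin p)) : Fin B → ℝ :=
  fun b => adjPValue X (N b)ᶜ (A.selected (N b) (ξ b) y) C y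

/-! ### Aggregation -/

/-- The empirical `γ`-quantile of `x_1, …, x_B`: the smallest `t` such that at least a fraction `γ`
of the `x_b` is at most `t`. -/
def empiricalQuantile {B : ℕ} (γ : ℝ) (x : Fin B → ℝ) : ℝ :=
  sInf {t : ℝ | γ * B ≤ ((Finset.univ.filter fun b => x b ≤ t).card : ℝ)}

/-- The aggregated p-value `Q^C(γ)`, as a function of the adjusted p-values of the splits. -/
def aggregate {B : ℕ} (γ : ℝ) (x : Fin B → ℝ) : ℝ :=
  min 1 (empiricalQuantile γ fun b => x b / γ)

/-- The aggregated p-value `P^C`, as a function of the adjusted p-values of the splits. -/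
def aggregateInf {B : ℕ} (γmin : ℝ) (x : Fin B → ℝ) : ℝ :=
  min 1 ((1 - Real.log γmin) * sInf ((fun γ => aggregate γ x) '' Set.Ioo γmin 1))

/-- The hierarchically adjusted p-values `Q_h^C(γ)`. -/
def Qh {n p B : ℕ} {U : Type*} [MeasurableSpace U] (X : Matrix (Fin n) (Fin p) ℝ)
    (T : Hierarchy p) (A : Screening n p U) (γ : ℝ) (N : Fin B → Finset (Fin n)) (ξ : Fin B → U)
    (y : Fin n → ℝ) : Finset (Fin p) → ℝ :=
  T.adjust fun D => aggregate γ (splitPValues X A N ξ y D)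

/-- The hierarchically adjusted p-values `P_h^C`. -/
def Ph {n p B : ℕ} {U : Type*} [MeasurableSpace U] (X : Matrix (Fin n) (Fin p) ℝ)
    (T : Hierarchy p) (A : Screening n p U) (γmin : ℝ) (N : Fin B → Finset (Fin n))
    (ξ : Fin B → U) (y : Fin n → ℝ) : Finset (Fin p) → ℝ :=
  T.adjust fun D => aggregateInf γmin (splitPValues X A N ξ y D)

end HierTest

end

/-!
The proof has a probabilistic and a combinatorial side.

*One split.* Write `ε = σ Z` with `Z` standard Gaussian. The split, the seed and the coordinates of
`Z` in the screening half are independent of the coordinates in the other half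
(`measure_inter_restrictTo_compl`), so the screened set `S` may be regarded as fixed when the
F-test is carried out. If `S` contains the active set and the null hypothesis for `C` is true, the
mean of the response lies in the column space of the smaller model, and the F-statistic is the ratio
of the normalized squared lengths of the projections of `Z` onto two orthogonal subspaces, of
dimensions `#(C ∩ S)` and `#I - #S`. Both projections are standard Gaussian and they are independent
(`map_stdGaussian_eq_prod`), so the statistic has the F distribution
(`map_noiseFStatistic`), and its upper tail probability is a valid p-value
(`stdGaussian_noisePValue_le`).

*One hierarchy.* By the hierarchical adjustment a false rejection entails the rejection of an
inclusion-maximal true null cluster. These clusters are disjoint, so the weights `#(D ∩ S) / #S` of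
the multiplicity adjustment sum to at most `1`, and the adjusted p-values of a split satisfy
`∑_D P(p_D ≤ t) ≤ t` (`sum_measure_screenedPValue_le`).

*Aggregation.* If the `γ`-quantile of `p_D / γ` is at most `a`, the average over the splits of
`1{p_D ≤ a γ} / γ` is at least `1`. Markov's inequality and the preceding bound give the level `a`
for fixed `γ` (`measureReal_exists_aggregate_le`). For the infimum over `γ ∈ (γmin, 1)` the
indicator is replaced by a weight that dominates it for all `γ` at once (`supWeight`), whose mean
picks up the factor `1 + ∫_1^{1/γmin} ds / s = 1 - log γmin`
(`measureReal_exists_aggregateInf_le`).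

*All splits.* Given the noise, the events that the screened sets contain the active set are
independent with equal probabilities, so by Jensen's inequality they occur simultaneously with
probability at least `(1 - δ) ^ B` (`pow_le_measureReal_forall`).
-/

open MeasureTheory ProbabilityTheory

noncomputable section

namespace HierTest

open scoped RealInnerProductSpace
open Module Matrix

/-! ### Orthogonal decompositions of Gaussian vectors -/

section Gaussian

variable {E F₁ F₂ : Type*}
  [NormedAddCommGroup E] [InnerProductSpace ℝ E] [FiniteDimensional ℝ E]
  [MeasurableSpace E] [BorelSpace E]
  [NormedAddCommGroup F₁] [InnerProductSpace ℝ F₁] [FiniteDimensional ℝ F₁]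
  [MeasurableSpace F₁] [BorelSpace F₁]
  [NormedAddCommGroup F₂] [InnerProductSpace ℝ F₂] [FiniteDimensional ℝ F₂]
  [MeasurableSpace F₂] [BorelSpace F₂]

/-- If `(f₁, f₂)` has an isometric adjoint `g : F₁ × F₂ → E` (for the Hilbert norm on the product),
it maps a standard Gaussian vector to two independent standard Gaussian vectors. -/
theorem map_stdGaussian_eq_prod {f₁ : E → F₁} {f₂ : E → F₂} (hf₁ : Measurable f₁)
    (hf₂ : Measurable f₂) (g : F₁ → F₂ → E)
    (hadj : ∀ z t s, ⟪f₁ z, t⟫ + ⟪f₂ z, s⟫ = ⟪z, g t s⟫)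
    (hnorm : ∀ t s, ‖g t s‖ ^ 2 = ‖t‖ ^ 2 + ‖s‖ ^ 2) :
    (stdGaussian E).map (fun z => (f₁ z, f₂ z)) = (stdGaussian F₁).prod (stdGaussian F₂) := by
  have hf : Measurable fun z => (f₁ z, f₂ z) := hf₁.prodMk hf₂
  have : IsProbabilityMeasure ((stdGaussian E).map (fun z => (f₁ z, f₂ z))) :=
    Measure.isProbabilityMeasure_map hf.aemeasurable
  rw [← charFun_eq_prod_iff]
  intro t
  have h : charFun (((stdGaussian E).map fun z => (f₁ z, f₂ z)).map (WithLp.toLp 2)) t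
      = charFun (stdGaussian E) (g (WithLp.ofLp t).1 (WithLp.ofLp t).2) := by
    have hm : Measurable (WithLp.toLp 2 : F₁ × F₂ → WithLp 2 (F₁ × F₂)) :=
      (MeasurableEquiv.toLp 2 (F₁ × F₂)).measurable
    rw [Measure.map_map hm hf, charFun, charFun,
      integral_map (hm.comp hf).aemeasurable (Measurable.aestronglyMeasurable (by fun_prop))]
    simp only [Function.comp_apply, WithLp.prod_inner_apply]
    simp_rw [← hadj]
  rw [h, charFun_stdGaussian, charFun_stdGaussian, charFun_stdGaussian, ← Complex.exp_add]
  congr 1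
  have := hnorm (WithLp.ofLp t).1 (WithLp.ofLp t).2
  rw [← Complex.ofReal_pow, this]
  push_cast
  ring

/-- The coordinates in `I` of a vector in `ℝⁿ`. -/
def restrictTo {n : ℕ} (I : Finset (Fin n)) (z : EuclideanSpace ℝ (Fin n)) : EuclideanSpace ℝ I :=
  WithLp.toLp 2 fun i => z i

theorem measurable_restrictTo {n : ℕ} (I : Finset (Fin n)) : Measurable (restrictTo I) := by
  unfold restrictTo
  fun_prop

theorem map_restrictTo_stdGaussian {n : ℕ} (I : Finset (Fin n)) :
    (stdGaussian (EuclideanSpace ℝ (Fin n))).map (fun z => (restrictTo I z, restrictTo Iᶜ z)) =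
      (stdGaussian (EuclideanSpace ℝ I)).prod (stdGaussian (EuclideanSpace ℝ (Iᶜ : Finset _))) := by
  let g : EuclideanSpace ℝ I → EuclideanSpace ℝ (Iᶜ : Finset _) → EuclideanSpace ℝ (Fin n) :=
    fun t s => WithLp.toLp 2 fun i =>
      if h : i ∈ I then t ⟨i, h⟩ else s ⟨i, Finset.mem_compl.2 h⟩
  have key (f : Fin n → ℝ) (a : I → ℝ) (b : (Iᶜ : Finset (Fin n)) → ℝ)
      (ha : ∀ i, a i = f i) (hb : ∀ i, b i = f i) : ∑ i, a i + ∑ i, b i = ∑ i, f i := by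
    rw [← Finset.sum_add_sum_compl I f, ← Finset.sum_coe_sort I f, ← Finset.sum_coe_sort Iᶜ f]
    simp [ha, hb]
  refine map_stdGaussian_eq_prod (measurable_restrictTo I) (measurable_restrictTo _) g ?_ ?_
  · intro z t s
    simp only [PiLp.inner_apply, RCLike.inner_apply, conj_trivial]
    apply key
    · intro i
      simp [g, restrictTo]
    · intro i
      simp [g, restrictTo, Finset.mem_compl.1 i.2]
  · intro t s
    simp only [EuclideanSpace.real_norm_sq_eq]
    symm
    apply key
    · intro i
      simp [g]
    · intro i
      simp [g, Finset.mem_compl.1 i.2]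

theorem map_norm_sq_stdGaussian (F : Type*) [NormedAddCommGroup F] [InnerProductSpace ℝ F]
    [FiniteDimensional ℝ F] [MeasurableSpace F] [BorelSpace F] {k : ℕ} (hk : finrank ℝ F = k) :
    (stdGaussian F).map (fun z => ‖z‖ ^ 2) = chiSquared k := by
  subst hk
  let e := (stdOrthonormalBasis ℝ F).repr
  rw [chiSquared, ← stdGaussian_map e, Measure.map_map (by fun_prop) (by fun_prop)]
  congr 1
  ext z
  simp

/-- The squared lengths of the projections of a standard Gaussian vector onto two orthogonal
subspaces are independent chi-squared variables (Cochran's theorem). -/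
theorem map_norm_sq_starProjection_stdGaussian {K₁ K₂ : Submodule ℝ E} (h : K₁ ⟂ K₂) {k l : ℕ}
    (hk : finrank ℝ K₁ = k) (hl : finrank ℝ K₂ = l) :
    (stdGaussian E).map (fun z => (‖K₁.starProjection z‖ ^ 2, ‖K₂.starProjection z‖ ^ 2)) =
      (chiSquared k).prod (chiSquared l) := by
  have hprod : (stdGaussian E).map
      (fun z => (K₁.orthogonalProjectionOnto z, K₂.orthogonalProjectionOnto z)) =
      (stdGaussian K₁).prod (stdGaussian K₂) := by
    refine map_stdGaussian_eq_prod (by fun_prop) (by fun_prop) (fun t s => (t : E) + s) ?_ ?_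
    · intro z t s
      rw [inner_add_right, Submodule.inner_orthogonalProjectionOnto_eq_of_mem_right,
        Submodule.inner_orthogonalProjectionOnto_eq_of_mem_right]
    · intro t s
      have := norm_add_sq_eq_norm_sq_add_norm_sq_real (h.inner_eq t.2 s.2)
      simpa [sq] using this
  have : (stdGaussian E).map (fun z => (‖K₁.starProjection z‖ ^ 2, ‖K₂.starProjection z‖ ^ 2)) =
      ((stdGaussian E).map
      (fun z => (K₁.orthogonalProjectionOnto z, K₂.orthogonalProjectionOnto z))).map
        (Prod.map (fun x => ‖x‖ ^ 2) (fun x => ‖x‖ ^ 2)) := by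
    rw [Measure.map_map (by fun_prop) (by fun_prop)]
    rfl
  rw [this, hprod, ← Measure.map_prod_map _ _ (by fun_prop) (by fun_prop),
    map_norm_sq_stdGaussian _ hk, map_norm_sq_stdGaussian _ hl]

theorem multivariateGaussian_zero_sq_smul_one {n : ℕ} (σ : ℝ) :
    multivariateGaussian 0 (σ ^ 2 • (1 : Matrix (Fin n) (Fin n) ℝ)) =
      (stdGaussian (EuclideanSpace ℝ (Fin n))).map (fun z => σ • z) := by
  have hS : (σ ^ 2 • (1 : Matrix (Fin n) (Fin n) ℝ)).PosSemidef :=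
    Matrix.PosSemidef.one.smul (sq_nonneg σ)
  have : IsProbabilityMeasure ((stdGaussian (EuclideanSpace ℝ (Fin n))).map (fun z => σ • z)) :=
    Measure.isProbabilityMeasure_map (by fun_prop)
  refine Measure.ext_of_charFun (funext fun t => ?_)
  have hq : t.ofLp ⬝ᵥ (σ ^ 2 • (1 : Matrix (Fin n) (Fin n) ℝ)).mulVec t.ofLp =
      (‖σ‖ * ‖t‖) ^ 2 := by
    rw [Matrix.smul_mulVec, Matrix.one_mulVec, dotProduct_smul, mul_pow, Real.norm_eq_abs, sq_abs,
      EuclideanSpace.real_norm_sq_eq, smul_eq_mul]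
    simp [dotProduct, sq]
  rw [charFun_multivariateGaussian hS, charFun_map_smul, charFun_stdGaussian, norm_smul, hq,
    inner_zero_right]
  congr 1
  push_cast
  ring

end Gaussian

/-! ### The null distribution of the partial F-statistic -/

section Projection

variable {E : Type*} [NormedAddCommGroup E] [InnerProductSpace ℝ E] [FiniteDimensional ℝ E]

/-- For nested subspaces `W₀ ≤ W`, projecting onto `W` and then off `W₀` is projecting onto the
orthogonal complement of `W₀` in `W`. -/
theorem starProjection_inf_orthogonal {W₀ W : Submodule ℝ E} (h : W₀ ≤ W) (z : E) :
    (W ⊓ W₀ᗮ).starProjection z = W.starProjection z - W₀.starProjection z := by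
  have hmem : W.starProjection z - W₀.starProjection z ∈ W ⊓ W₀ᗮ := by
    refine Submodule.mem_inf.2 ⟨?_, ?_⟩
    · exact W.sub_mem (W.starProjection_apply_mem z) (h (W₀.starProjection_apply_mem z))
    · have : W.starProjection z - W₀.starProjection z =
          (z - W₀.starProjection z) - (z - W.starProjection z) := by abel
      rw [this]
      exact W₀ᗮ.sub_mem (W₀.sub_starProjection_mem_orthogonal z)
        (Submodule.orthogonal_le h (W.sub_starProjection_mem_orthogonal z))
  refine Submodule.eq_starProjection_of_mem_orthogonal hmem ?_
  rw [sub_sub_eq_add_sub, add_sub_right_comm]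
  refine Submodule.add_mem _ ?_ ?_
  · exact Submodule.orthogonal_le inf_le_left (W.sub_starProjection_mem_orthogonal z)
  · exact Submodule.orthogonal_le inf_le_right
      (Submodule.le_orthogonal_orthogonal W₀ (W₀.starProjection_apply_mem z))

theorem norm_sub_starProjection_sq_add_smul {W : Submodule ℝ E} {m : E} (hm : m ∈ W) (σ : ℝ)
    (z : E) : ‖(m + σ • z) - W.starProjection (m + σ • z)‖ ^ 2 =
      σ ^ 2 * ‖Wᗮ.starProjection z‖ ^ 2 := by
  have : (m + σ • z) - W.starProjection (m + σ • z) = σ • Wᗮ.starProjection z := by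
    rw [map_add, map_smul, Submodule.starProjection_eq_self_iff.2 hm,
      Submodule.starProjection_orthogonal_val, smul_sub]
    abel
  rw [this, norm_smul, mul_pow, Real.norm_eq_abs, sq_abs]

theorem norm_starProjection_orthogonal_sq_sub {W₀ W : Submodule ℝ E} (h : W₀ ≤ W) (z : E) :
    ‖W₀ᗮ.starProjection z‖ ^ 2 - ‖Wᗮ.starProjection z‖ ^ 2 =
      ‖(W ⊓ W₀ᗮ).starProjection z‖ ^ 2 := by
  have h1 : W₀ᗮ.starProjection z = (W ⊓ W₀ᗮ).starProjection z + Wᗮ.starProjection z := by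
    rw [starProjection_inf_orthogonal h, Submodule.starProjection_orthogonal_val,
      Submodule.starProjection_orthogonal_val]
    abel
  have h2 : ⟪(W ⊓ W₀ᗮ).starProjection z, Wᗮ.starProjection z⟫ = 0 :=
    Submodule.inner_right_of_mem_orthogonal (K := W)
      (Submodule.mem_inf.1 ((W ⊓ W₀ᗮ).starProjection_apply_mem z)).1
      (Submodule.starProjection_apply_mem _ z)
  have := norm_add_sq_eq_norm_sq_add_norm_sq_real h2
  rw [h1]
  linarith [this, sq (‖(W ⊓ W₀ᗮ).starProjection z + Wᗮ.starProjection z‖),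
    sq ‖(W ⊓ W₀ᗮ).starProjection z‖, sq ‖Wᗮ.starProjection z‖]

end Projection

section FTest

variable {n p : ℕ} {X : Matrix (Fin n) (Fin p) ℝ} {J : Finset (Fin n)} {S C M : Finset (Fin p)}

theorem columnSpace_mono (h : M ⊆ S) : columnSpace X J M ≤ columnSpace X J S :=
  Submodule.span_mono (Set.image_mono (by exact_mod_cast h))

theorem finrank_columnSpace
    (hLI : LinearIndependent ℝ fun (j : S) (i : J) => X i j) (h : M ⊆ S) :
    finrank ℝ (columnSpace X J M) = M.card := by
  have h1 : LinearIndependent ℝ fun (j : M) =>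
      (WithLp.toLp 2 fun i : J => X i j : EuclideanSpace ℝ J) := by
    have h2 : LinearIndependent ℝ fun (j : M) (i : J) => X i j :=
      hLI.comp (fun j : M => (⟨j, h j.2⟩ : S)) fun a b hab =>
        Subtype.ext (congrArg (fun x : S => (x : Fin p)) hab)
    exact h2.map' (WithLp.linearEquiv 2 ℝ (J → ℝ)).symm.toLinearMap (LinearEquiv.ker _)
  have := finrank_span_eq_card h1
  rw [Fintype.card_coe] at this
  rw [← this, columnSpace, Set.image_eq_range]
  rfl

/-- The mean of the response belongs to the column space of every model that contains all active
variables. -/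
theorem mulVec_mem_columnSpace {β : Fin p → ℝ} (h : ∀ j, j ∉ M → β j = 0) :
    (WithLp.toLp 2 fun i : J => (X.mulVec β) i : EuclideanSpace ℝ J) ∈ columnSpace X J M := by
  have : (WithLp.toLp 2 fun i : J => (X.mulVec β) i : EuclideanSpace ℝ J) =
      ∑ j ∈ M, β j • (WithLp.toLp 2 fun i : J => X i j : EuclideanSpace ℝ J) := by
    ext i
    simp only [Matrix.mulVec, dotProduct, WithLp.ofLp_sum, WithLp.ofLp_smul, Finset.sum_apply,
      Pi.smul_apply, smul_eq_mul]
    rw [Finset.sum_subset (Finset.subset_univ M) fun j _ hj => by rw [h j hj, zero_mul]]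
    exact Finset.sum_congr rfl fun j _ => mul_comm _ _
  rw [this]
  exact Submodule.sum_mem _ fun j hj => Submodule.smul_mem _ _
    (Submodule.subset_span ⟨j, by exact_mod_cast hj, rfl⟩)

theorem rss_response {β : Fin p → ℝ} (h : ∀ j, j ∉ M → β j = 0) (σ : ℝ)
    (z : EuclideanSpace ℝ (Fin n)) :
    rss X J M (response X β (σ • z)) =
      σ ^ 2 * ‖(columnSpace X J M)ᗮ.starProjection (restrictTo J z)‖ ^ 2 :=
  norm_sub_starProjection_sq_add_smul (mulVec_mem_columnSpace h) σ (restrictTo J z)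

/-- Under the null hypothesis the F-statistic compares the components of the noise in two
orthogonal subspaces. -/
theorem fStatistic_response {β : Fin p → ℝ} (hS : activeSet β ⊆ S) (hC : NullHypothesis β C)
    {σ : ℝ} (hσ : σ ≠ 0) (z : EuclideanSpace ℝ (Fin n)) :
    fStatistic X J S C (response X β (σ • z)) =
      (‖(columnSpace X J S ⊓ (columnSpace X J (S \ C))ᗮ).starProjection (restrictTo J z)‖ ^ 2
        / (C ∩ S).card) /
      (‖(columnSpace X J S)ᗮ.starProjection (restrictTo J z)‖ ^ 2
        / ((J.card - S.card : ℕ) : ℝ)) := by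
  have h1 : ∀ j, j ∉ S → β j = 0 := fun j hj => by
    by_contra h
    exact hj (hS (Finset.mem_filter.2 ⟨Finset.mem_univ j, h⟩))
  have h2 : ∀ j, j ∉ S \ C → β j = 0 := fun j hj => by
    by_cases hjC : j ∈ C
    · exact hC j hjC
    · exact h1 j fun hjS => hj (Finset.mem_sdiff.2 ⟨hjS, hjC⟩)
  rw [fStatistic, rss_response h1, rss_response h2, ← mul_sub,
    norm_starProjection_orthogonal_sq_sub (columnSpace_mono Finset.sdiff_subset),
    mul_div_assoc _ _ ((C ∩ S).card : ℝ), mul_div_assoc _ _ ((J.card - S.card : ℕ) : ℝ),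
    mul_div_mul_left _ _ (pow_ne_zero 2 hσ)]

/-- The right-hand side of `fStatistic_response` as a function of the standard Gaussian noise
on the observations `J`. -/
def noiseFStatistic (X : Matrix (Fin n) (Fin p) ℝ) (J : Finset (Fin n)) (S C : Finset (Fin p))
    (w : EuclideanSpace ℝ J) : ℝ :=
  (‖(columnSpace X J S ⊓ (columnSpace X J (S \ C))ᗮ).starProjection w‖ ^ 2 / (C ∩ S).card) /
    (‖(columnSpace X J S)ᗮ.starProjection w‖ ^ 2 / ((J.card - S.card : ℕ) : ℝ))

theorem measurable_noiseFStatistic : Measurable (noiseFStatistic X J S C) := by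
  unfold noiseFStatistic
  fun_prop

/-- The residual degrees of freedom may be zero here: then both sides involve the same division by
zero. -/
theorem map_noiseFStatistic (hLI : LinearIndependent ℝ fun (j : S) (i : J) => X i j) :
    (stdGaussian (EuclideanSpace ℝ J)).map (noiseFStatistic X J S C) =
      fDistribution (C ∩ S).card (J.card - S.card) := by
  set W := columnSpace X J S
  set W₀ := columnSpace X J (S \ C)
  have hW : finrank ℝ W = S.card := finrank_columnSpace hLI subset_rfl
  have hW₀ : finrank ℝ W₀ = (S \ C).card := finrank_columnSpace hLI Finset.sdiff_subset
  have hl : finrank ℝ (Wᗮ : Submodule ℝ (EuclideanSpace ℝ J)) = J.card - S.card := by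
    have := W.finrank_add_finrank_orthogonal
    rw [finrank_euclideanSpace, Fintype.card_coe] at this
    omega
  have hk : finrank ℝ (W ⊓ W₀ᗮ : Submodule ℝ (EuclideanSpace ℝ J)) = (C ∩ S).card := by
    have := Submodule.finrank_add_inf_finrank_orthogonal
      (columnSpace_mono (X := X) (J := J) (Finset.sdiff_subset (s := S) (t := C)))
    change finrank ℝ W₀ + finrank ℝ (W₀ᗮ ⊓ W : Submodule ℝ (EuclideanSpace ℝ J)) =
      finrank ℝ W at this
    rw [inf_comm] at this
    have h3 := Finset.card_sdiff_add_card_inter S C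
    rw [Finset.inter_comm] at h3
    omega
  have horth : (W ⊓ W₀ᗮ) ⟂ Wᗮ := by
    rw [Submodule.isOrtho_iff_le]
    exact inf_le_left.trans (Submodule.le_orthogonal_orthogonal W)
  rw [fDistribution, ← map_norm_sq_starProjection_stdGaussian horth hk hl,
    Measure.map_map (by fun_prop) (by fun_prop)]
  rfl

/-! ### Validity of p-values -/

instance (k : ℕ) : IsProbabilityMeasure (chiSquared k) :=
  Measure.isProbabilityMeasure_map (by fun_prop)

instance (k l : ℕ) : IsProbabilityMeasure (fDistribution k l) :=
  Measure.isProbabilityMeasure_map (by fun_prop)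

theorem antitone_measureReal_Ici (ν : Measure ℝ) [IsFiniteMeasure ν] :
    Antitone fun x => ν.real (Set.Ici x) :=
  fun _ _ h => measureReal_mono (Set.Ici_subset_Ici.2 h)

/-- The upper tail probability is a valid p-value, for every law `ν` (possibly with atoms). Inner
regularity reduces the claim to compact sets, and these are contained in the upper tail at their
least element. -/
theorem measure_tail_le (ν : Measure ℝ) [IsFiniteMeasure ν] (u : ℝ) :
    ν {x | ν.real (Set.Ici x) ≤ u} ≤ ENNReal.ofReal u := by
  have hm : MeasurableSet {x | ν.real (Set.Ici x) ≤ u} :=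
    (antitone_measureReal_Ici ν).measurable measurableSet_Iic
  rw [hm.measure_eq_iSup_isCompact ν]
  refine iSup_le fun K => iSup_le fun hK => iSup_le fun hc => ?_
  rcases K.eq_empty_or_nonempty with rfl | hne
  · simp
  · obtain ⟨a, ha, hle⟩ := hc.exists_isLeast hne
    have h1 : ν K ≤ ν (Set.Ici a) := measure_mono fun x hx => hle hx
    refine h1.trans ?_
    rw [← ofReal_measureReal]
    exact ENNReal.ofReal_le_ofReal (hK ha)

/-- The p-value of the partial F-test under the null hypothesis, as a function of the standard
Gaussian noise on the observations `J`. -/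
def noisePValue (X : Matrix (Fin n) (Fin p) ℝ) (J : Finset (Fin n)) (S C : Finset (Fin p))
    (w : EuclideanSpace ℝ J) : ℝ :=
  (fDistribution (C ∩ S).card (J.card - S.card)).real (Set.Ici (noiseFStatistic X J S C w))

theorem measurable_noisePValue : Measurable (noisePValue X J S C) :=
  (antitone_measureReal_Ici _).measurable.comp measurable_noiseFStatistic

theorem partialFPValue_response {β : Fin p → ℝ} (hS : activeSet β ⊆ S) (hC : NullHypothesis β C)
    {σ : ℝ} (hσ : σ ≠ 0) (z : EuclideanSpace ℝ (Fin n)) :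
    partialFPValue X J S C (response X β (σ • z)) = noisePValue X J S C (restrictTo J z) := by
  rw [partialFPValue, fStatistic_response hS hC hσ, noisePValue, noiseFStatistic]

theorem stdGaussian_noisePValue_le (hLI : LinearIndependent ℝ fun (j : S) (i : J) => X i j)
    (u : ℝ) :
    stdGaussian (EuclideanSpace ℝ J) {w | noisePValue X J S C w ≤ u} ≤ ENNReal.ofReal u := by
  have hm : MeasurableSet
      {x | (fDistribution (C ∩ S).card (J.card - S.card)).real (Set.Ici x) ≤ u} :=
    (antitone_measureReal_Ici _).measurable measurableSet_Iic
  have h := measure_tail_le (fDistribution (C ∩ S).card (J.card - S.card)) u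
  rwa [← map_noiseFStatistic hLI, Measure.map_apply measurable_noiseFStatistic,
    map_noiseFStatistic hLI] at h
  rwa [map_noiseFStatistic hLI]

end FTest

/-! ### Aggregation over splits -/

theorem le_card_of_empiricalQuantile_lt {B : ℕ} {γ : ℝ} (hγ : γ ≤ 1) {x : Fin B → ℝ} {a : ℝ}
    (h : empiricalQuantile γ x < a) :
    γ * B ≤ ((Finset.univ.filter fun b => x b ≤ a).card : ℝ) := by
  have hne : {t : ℝ | γ * B ≤ ((Finset.univ.filter fun b => x b ≤ t).card : ℝ)}.Nonempty := by
    obtain ⟨t, ht⟩ := (Set.finite_range x).bddAbove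
    refine ⟨t, ?_⟩
    have : (Finset.univ.filter fun b => x b ≤ t) = Finset.univ :=
      Finset.filter_true_of_mem fun b _ => ht ⟨b, rfl⟩
    simp only [Set.mem_ofPred_eq, this, Finset.card_univ, Fintype.card_fin]
    exact mul_le_of_le_one_left (Nat.cast_nonneg B) hγ
  obtain ⟨t, ht, hta⟩ := exists_lt_of_csInf_lt hne h
  refine le_trans ht ?_
  exact_mod_cast Finset.card_le_card
    (Finset.monotone_filter_right _ fun b _ (hb : x b ≤ t) => hb.trans hta.le)

theorem le_card_of_aggregate_lt {B : ℕ} {γ : ℝ} (hγ0 : 0 < γ) (hγ : γ ≤ 1) {x : Fin B → ℝ} {a : ℝ}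
    (ha : a ≤ 1) (h : aggregate γ x < a) :
    γ * B ≤ ((Finset.univ.filter fun b => x b ≤ a * γ).card : ℝ) := by
  have h1 : empiricalQuantile γ (fun b => x b / γ) < a :=
    (min_lt_iff.1 h).resolve_left ha.not_gt
  simpa only [div_le_iff₀ hγ0] using le_card_of_empiricalQuantile_lt hγ h1

/-- If at least a fraction `γ` of the `x_b` has weight at least `1 / γ`, the average weight is at
least `1`. -/
theorem le_sum_weight {B : ℕ} {γ : ℝ} (hγ0 : 0 < γ) {x : Fin B → ℝ} {c : ℝ}
    (h : γ * B ≤ ((Finset.univ.filter fun b => x b ≤ c).card : ℝ)) {φ : ℝ → ENNReal}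
    (hφ : ∀ t ≤ c, ENNReal.ofReal (1 / γ) ≤ φ t) :
    (B : ENNReal) ≤ ∑ b, φ (x b) := by
  calc (B : ENNReal) = ENNReal.ofReal (γ * B) * ENNReal.ofReal (1 / γ) := by
        rw [← ENNReal.ofReal_mul (by positivity), ← ENNReal.ofReal_natCast]
        congr 1
        field_simp
    _ ≤ ENNReal.ofReal ((Finset.univ.filter fun b => x b ≤ c).card : ℝ) *
          ENNReal.ofReal (1 / γ) := by gcongr
    _ = ∑ b ∈ Finset.univ.filter fun b => x b ≤ c, ENNReal.ofReal (1 / γ) := by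
        rw [ENNReal.ofReal_natCast, Finset.sum_const, nsmul_eq_mul]
    _ ≤ ∑ b ∈ Finset.univ.filter fun b => x b ≤ c, φ (x b) :=
        Finset.sum_le_sum fun b hb => hφ _ (Finset.mem_filter.1 hb).2
    _ ≤ ∑ b, φ (x b) := Finset.sum_le_sum_of_subset (Finset.filter_subset _ _)

section Aggregation

variable {Ω κ : Type*} [MeasurableSpace Ω] {μ : Measure Ω} {B : ℕ}
  {M : Finset κ} {x : κ → Fin B → Ω → ℝ}

/-- Markov's inequality for the average weight, and a union bound over the hypotheses. -/
theorem measure_exists_le_sum_weight (hB : 0 < B) (hx : ∀ D ∈ M, ∀ b, Measurable (x D b))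
    {φ : ℝ → ENNReal} (hφ : Measurable φ) {c : ENNReal}
    (hc : ∀ b, ∑ D ∈ M, ∫⁻ ω, φ (x D b ω) ∂μ ≤ c) :
    μ {ω | ∃ D ∈ M, (B : ENNReal) ≤ ∑ b, φ (x D b ω)} ≤ c := by
  have hB0 : (B : ENNReal) ≠ 0 := by exact_mod_cast hB.ne'
  have hset : {ω | ∃ D ∈ M, (B : ENNReal) ≤ ∑ b, φ (x D b ω)} =
      ⋃ D ∈ M, {ω | (B : ENNReal) ≤ ∑ b, φ (x D b ω)} := by
    ext ω
    simp
  have hm : ∀ D ∈ M, ∀ b, Measurable fun ω => φ (x D b ω) := fun D hD b => hφ.comp (hx D hD b)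
  rw [hset]
  calc μ (⋃ D ∈ M, {ω | (B : ENNReal) ≤ ∑ b, φ (x D b ω)})
      ≤ ∑ D ∈ M, μ {ω | (B : ENNReal) ≤ ∑ b, φ (x D b ω)} := measure_biUnion_finset_le _ _
    _ ≤ ∑ D ∈ M, (∫⁻ ω, ∑ b, φ (x D b ω) ∂μ) / B := by
        refine Finset.sum_le_sum fun D hD => ?_
        exact meas_ge_le_lintegral_div
          (Finset.measurable_sum _ fun b _ => hm D hD b).aemeasurable hB0 (ENNReal.natCast_ne_top B)
    _ = (∑ b, ∑ D ∈ M, ∫⁻ ω, φ (x D b ω) ∂μ) / B := by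
        rw [Finset.sum_comm]
        simp_rw [div_eq_mul_inv]
        rw [← Finset.sum_mul]
        congr 1
        exact Finset.sum_congr rfl fun D hD => lintegral_finsetSum _ fun b _ => hm D hD b
    _ ≤ (∑ _b : Fin B, c) / B := by
        gcongr with b
        exact hc b
    _ = c := by
        rw [Finset.sum_const, Finset.card_univ, Fintype.card_fin, nsmul_eq_mul, mul_comm]
        exact ENNReal.mul_div_cancel_right hB0 (ENNReal.natCast_ne_top B)

/-- If, for every split, the p-values of the hypotheses in `M` satisfy a Bonferroni type
inequality, then so do the aggregated p-values for fixed `γ`. -/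
theorem measureReal_exists_aggregate_le [IsProbabilityMeasure μ] (hB : 0 < B)
    (hx : ∀ D ∈ M, ∀ b, Measurable (x D b))
    (hsum : ∀ b, ∀ t : ℝ, 0 < t → t < 1 →
      ∑ D ∈ M, μ {ω | x D b ω ≤ t} ≤ ENNReal.ofReal t)
    {γ : ℝ} (hγ0 : 0 < γ) (hγ1 : γ < 1) {α : ℝ} (hα : 0 < α) :
    μ.real {ω | ∃ D ∈ M, aggregate γ (fun b => x D b ω) ≤ α} ≤ α := by
  -- a level `a` slightly above `α` avoids having to attain the infimum in the quantile
  refine le_of_forall_gt_imp_ge_of_dense fun a ha => ?_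
  have ha0 : 0 < a := hα.trans ha
  rcases le_or_gt 1 a with ha1 | ha1
  · exact measureReal_le_one.trans ha1
  let φ : ℝ → ENNReal := (Set.Iic (a * γ)).indicator fun _ => ENNReal.ofReal (1 / γ)
  have hφ : Measurable φ := measurable_const.indicator measurableSet_Iic
  refine ENNReal.toReal_le_of_le_ofReal ha0.le (le_trans (measure_mono ?_)
    (measure_exists_le_sum_weight hB hx hφ (c := ENNReal.ofReal a) fun b => ?_))
  · rintro ω ⟨D, hD, h⟩
    refine ⟨D, hD, le_sum_weight hγ0
      (le_card_of_aggregate_lt hγ0 hγ1.le ha1.le (h.trans_lt ha)) fun t ht => ?_⟩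
    simp only [φ, Set.indicator_of_mem (Set.mem_Iic.2 ht), le_refl]
  · have h1 : ∀ D ∈ M, ∫⁻ ω, φ (x D b ω) ∂μ =
        ENNReal.ofReal (1 / γ) * μ {ω | x D b ω ≤ a * γ} := fun D hD =>
      lintegral_indicator_const (hx D hD b measurableSet_Iic) _
    rw [Finset.sum_congr rfl h1, ← Finset.mul_sum]
    calc _ ≤ ENNReal.ofReal (1 / γ) * ENNReal.ofReal (a * γ) := by
          gcongr
          exact hsum b _ (by positivity) (by nlinarith)
      _ = ENNReal.ofReal a := by
          rw [← ENNReal.ofReal_mul (by positivity)]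
          congr 1
          field_simp

/-- The weight `1{t ≤ a} + ∫_1^{1/γmin} 1{t ≤ a / s} ds`. It dominates `1{t ≤ a γ} / γ`
simultaneously for all `γ ∈ (γmin, 1)`. -/
def supWeight (γmin a t : ℝ) : ENNReal :=
  (Set.Iic a).indicator (fun _ => 1) t +
    ∫⁻ s in Set.Ioc 1 (1 / γmin), (Set.Iic (a / s)).indicator (fun _ => 1) t

theorem measurable_indicator_Iic_div (a : ℝ) :
    Measurable fun q : ℝ × ℝ => (Set.Iic (a / q.2)).indicator (fun _ => (1 : ENNReal)) q.1 := by
  have : MeasurableSet {q : ℝ × ℝ | q.1 ≤ a / q.2} :=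
    measurableSet_le measurable_fst (measurable_const.div measurable_snd)
  exact (measurable_const (a := (1 : ENNReal))).indicator this

theorem measurable_supWeight (γmin a : ℝ) : Measurable (supWeight γmin a) :=
  (measurable_const.indicator measurableSet_Iic).add
    (measurable_indicator_Iic_div a).lintegral_prod_right'

theorem le_supWeight {γmin γ a t : ℝ} (h0 : 0 < γmin) (hγ : γmin < γ) (hγ1 : γ < 1) (ha : 0 ≤ a)
    (ht : t ≤ a * γ) : ENNReal.ofReal (1 / γ) ≤ supWeight γmin a t := by
  have hγ0 : 0 < γ := h0.trans hγ
  have h1 : 1 ≤ 1 / γ := by rw [le_div_iff₀ hγ0]; linarith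
  calc ENNReal.ofReal (1 / γ) = 1 + ENNReal.ofReal (1 / γ - 1) := by
        rw [← ENNReal.ofReal_one, ← ENNReal.ofReal_add zero_le_one (by linarith)]
        congr 1
        ring
    _ = 1 + ∫⁻ s in Set.Ioc 1 (1 / γ), 1 := by
        rw [setLIntegral_one, Real.volume_Ioc]
    _ ≤ supWeight γmin a t := by
        refine add_le_add ?_ ?_
        · rw [Set.indicator_of_mem]
          exact ht.trans (mul_le_of_le_one_right ha hγ1.le)
        · refine le_trans (setLIntegral_mono' measurableSet_Ioc fun s hs => ?_)
            (lintegral_mono_set (Set.Ioc_subset_Ioc_right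
              (one_div_le_one_div_of_le h0 hγ.le)))
          have hs0 : 0 < s := zero_lt_one.trans hs.1
          rw [Set.indicator_of_mem]
          refine ht.trans ?_
          rw [le_div_iff₀ hs0, mul_assoc]
          refine mul_le_of_le_one_right ha ?_
          rw [mul_comm]
          exact (le_div_iff₀ hγ0).1 hs.2

theorem lintegral_Ioc_ofReal_div {γmin a : ℝ} (h0 : 0 < γmin) (h1 : γmin < 1) (ha : 0 ≤ a) :
    ∫⁻ s in Set.Ioc 1 (1 / γmin), ENNReal.ofReal (a / s) =
      ENNReal.ofReal (a * -Real.log γmin) := by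
  have hle : 1 ≤ 1 / γmin := by rw [le_div_iff₀ h0]; linarith
  have hint : IntervalIntegrable (fun s : ℝ => a / s) volume 1 (1 / γmin) := by
    refine ContinuousOn.intervalIntegrable_of_Icc hle
      (continuousOn_const.div continuousOn_id fun s hs => ?_)
    exact (zero_lt_one.trans_le hs.1).ne'
  rw [← ofReal_integral_eq_lintegral_ofReal
    ((intervalIntegrable_iff_integrableOn_Ioc_of_le hle).1 hint)
    ((ae_restrict_iff' measurableSet_Ioc).2 (.of_forall fun s hs =>
      div_nonneg ha (zero_le_one.trans hs.1.le))),
    ← intervalIntegral.integral_of_le hle]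
  simp_rw [div_eq_mul_inv]
  rw [intervalIntegral.integral_const_mul, integral_inv_of_pos one_pos (by positivity)]
  simp [Real.log_inv]

theorem sum_lintegral_supWeight_le [SFinite μ] {y : κ → Ω → ℝ} (hy : ∀ D ∈ M, Measurable (y D))
    (hsum : ∀ t : ℝ, 0 < t → t < 1 → ∑ D ∈ M, μ {ω | y D ω ≤ t} ≤ ENNReal.ofReal t)
    {γmin a : ℝ} (h0 : 0 < γmin) (h1 : γmin < 1) (ha : 0 < a) (ha1 : a < 1) :
    ∑ D ∈ M, ∫⁻ ω, supWeight γmin a (y D ω) ∂μ ≤ ENNReal.ofReal (a * (1 - Real.log γmin)) := by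
  have key : ∀ D ∈ M, ∫⁻ ω, supWeight γmin a (y D ω) ∂μ = μ {ω | y D ω ≤ a} +
      ∫⁻ s in Set.Ioc 1 (1 / γmin), μ {ω | y D ω ≤ a / s} := by
    intro D hD
    have hI : ∀ c, ∫⁻ ω, (Set.Iic c).indicator (fun _ => (1 : ENNReal)) (y D ω) ∂μ =
        μ {ω | y D ω ≤ c} := fun c => by
      have := lintegral_indicator_const (μ := μ) (hy D hD (measurableSet_Iic (a := c))) 1
      rw [one_mul] at this
      exact this
    have hmeas : Measurable fun q : Ω × ℝ =>
        (Set.Iic (a / q.2)).indicator (fun _ => (1 : ENNReal)) (y D q.1) :=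
      (measurable_indicator_Iic_div a).comp (((hy D hD).comp measurable_fst).prodMk measurable_snd)
    have hind : Measurable fun ω => (Set.Iic a).indicator (fun _ => (1 : ENNReal)) (y D ω) :=
      (measurable_const.indicator measurableSet_Iic).comp (hy D hD)
    unfold supWeight
    rw [lintegral_add_left hind, hI,
      lintegral_lintegral_swap hmeas.aemeasurable]
    simp_rw [hI]
  have hmono : ∀ D, Measurable fun s : ℝ => μ {ω | y D ω ≤ s} := fun D =>
    Monotone.measurable fun s t hst => measure_mono fun ω (hω : y D ω ≤ s) => hω.trans hst
  have hdiv : ∀ D ∈ M, Measurable fun s : ℝ => μ {ω | y D ω ≤ a / s} := fun D _ =>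
    (hmono D).comp (measurable_const.div measurable_id)
  rw [Finset.sum_congr rfl key, Finset.sum_add_distrib, ← lintegral_finsetSum M hdiv]
  have hlog : Real.log γmin ≤ 0 := Real.log_nonpos h0.le h1.le
  calc _ ≤ ENNReal.ofReal a + ∫⁻ s in Set.Ioc 1 (1 / γmin), ENNReal.ofReal (a / s) := by
        refine add_le_add (hsum a ha ha1) (setLIntegral_mono' measurableSet_Ioc fun s hs => ?_)
        have hs0 : 0 < s := zero_lt_one.trans hs.1
        refine hsum _ (by positivity) ?_
        rw [div_lt_one hs0]
        exact ha1.trans hs.1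
    _ = ENNReal.ofReal (a * (1 - Real.log γmin)) := by
        rw [lintegral_Ioc_ofReal_div h0 h1 ha.le, ← ENNReal.ofReal_add ha.le
          (mul_nonneg ha.le (by linarith))]
        congr 1
        ring

/-- The analogue of `measureReal_exists_aggregate_le` for the p-values that are aggregated over all
`γ ∈ (γmin, 1)`: the factor `1 - log γmin` is the price for the infimum. -/
theorem measureReal_exists_aggregateInf_le [IsProbabilityMeasure μ] (hB : 0 < B)
    (hx : ∀ D ∈ M, ∀ b, Measurable (x D b))
    (hsum : ∀ b, ∀ t : ℝ, 0 < t → t < 1 →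
      ∑ D ∈ M, μ {ω | x D b ω ≤ t} ≤ ENNReal.ofReal t)
    {γmin : ℝ} (h0 : 0 < γmin) (h1 : γmin < 1) {α : ℝ} (hα : 0 < α) :
    μ.real {ω | ∃ D ∈ M, aggregateInf γmin (fun b => x D b ω) ≤ α} ≤ α := by
  -- the infimum over `γ` need not be attained, hence a level `c` slightly above `α`
  refine le_of_forall_gt_imp_ge_of_dense fun c hc => ?_
  have hc0 : 0 < c := hα.trans hc
  rcases le_or_gt 1 c with hc1 | hc1
  · exact measureReal_le_one.trans hc1
  have hlog : Real.log γmin < 0 := Real.log_neg h0 h1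
  have hL : 1 < 1 - Real.log γmin := by linarith
  have hL0 : 0 < 1 - Real.log γmin := by linarith
  set L := 1 - Real.log γmin with hLdef
  have ha0 : 0 < c / L := by positivity
  have ha1 : c / L < 1 := by rw [div_lt_one hL0]; linarith
  refine ENNReal.toReal_le_of_le_ofReal hc0.le (le_trans (measure_mono ?_)
    (measure_exists_le_sum_weight hB hx (measurable_supWeight γmin (c / L))
      (c := ENNReal.ofReal c) fun b => ?_))
  · rintro ω ⟨D, hD, h⟩
    have h2 : L * sInf ((fun γ => aggregate γ fun b => x D b ω) '' Set.Ioo γmin 1) < c :=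
      (min_lt_iff.1 (lt_of_le_of_lt h hc)).resolve_left hc1.le.not_gt
    rw [mul_comm, ← lt_div_iff₀ hL0] at h2
    obtain ⟨_, ⟨γ, ⟨hγ, hγ1⟩, rfl⟩, hlt⟩ :=
      exists_lt_of_csInf_lt ((Set.nonempty_Ioo.2 h1).image _) h2
    have hγ0 : 0 < γ := h0.trans hγ
    exact ⟨D, hD, le_sum_weight hγ0 (le_card_of_aggregate_lt hγ0 hγ1.le ha1.le hlt)
      fun t ht => le_supWeight h0 hγ hγ1 ha0.le ht⟩
  · refine (sum_lintegral_supWeight_le (fun D hD => hx D hD b) (hsum b) h0 h1 ha0 ha1).trans ?_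
    rw [← hLdef, div_mul_cancel₀ c hL0.ne']

end Aggregation

/-! ### Maximal true null clusters -/

section Hierarchy

variable {p : ℕ} (T : Hierarchy p) (β : Fin p → ℝ)

/-- The inclusion-maximal clusters among those whose null hypothesis is true. -/
def Hierarchy.maximalNull : Finset (Finset (Fin p)) :=
  open scoped Classical in T.clusters.filter fun D => Maximal (· ∈ T.nullClusters β) D

variable {T β}

theorem Hierarchy.mem_maximalNull {D : Finset (Fin p)} :
    D ∈ T.maximalNull β ↔ Maximal (· ∈ T.nullClusters β) D := by
  classical
  exact Finset.mem_filter.trans ⟨fun h => h.2, fun h => ⟨h.prop.1, h⟩⟩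

/-- A null cluster is only rejected together with the maximal null cluster above it. -/
theorem Hierarchy.exists_maximalNull_le {f : Finset (Fin p) → ℝ} {α : ℝ}
    (h : (T.rejected (T.adjust f) α ∩ T.nullClusters β).Nonempty) :
    ∃ D ∈ T.maximalNull β, f D ≤ α := by
  obtain ⟨C, ⟨_, hrej⟩, hC⟩ := h
  have hfin : (T.nullClusters β).Finite := T.clusters.finite_toSet.subset fun D hD => hD.1
  obtain ⟨D, hCD, hD⟩ := hfin.exists_le_maximal hC
  refine ⟨D, mem_maximalNull.2 hD, le_trans ?_ hrej⟩
  exact Finset.le_sup' f (Finset.mem_filter.2 ⟨hD.prop.1, hCD⟩)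

theorem Hierarchy.pairwiseDisjoint_maximalNull :
    ((T.maximalNull β : Finset (Finset (Fin p))) : Set (Finset (Fin p))).PairwiseDisjoint id := by
  intro C hC D hD hne
  have hC' := mem_maximalNull.1 (Finset.mem_coe.1 hC)
  have hD' := mem_maximalNull.1 (Finset.mem_coe.1 hD)
  rcases T.nested_or_disjoint C hC'.prop.1 D hD'.prop.1 with h | h | h
  · exact absurd (hC'.eq_of_le hD'.prop h) hne
  · exact absurd (hD'.eq_of_le hC'.prop h).symm hne
  · exact h

/-- The weights `|D ∩ S| / |S|` of the multiplicity adjustment sum to at most `1` over the maximal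
null clusters. -/
theorem Hierarchy.sum_card_inter_div_le (S : Finset (Fin p)) :
    ∑ D ∈ T.maximalNull β, ((D ∩ S).card : ℝ) / S.card ≤ 1 := by
  rw [← Finset.sum_div]
  refine div_le_one_of_le₀ ?_ (Nat.cast_nonneg _)
  rw [← Nat.cast_sum, Nat.cast_le, ← Finset.card_biUnion]
  · exact Finset.card_le_card (Finset.biUnion_subset.2 fun D _ => Finset.inter_subset_right)
  · intro C hC D hD hne
    exact (pairwiseDisjoint_maximalNull hC hD hne).mono Finset.inter_subset_left
      Finset.inter_subset_left

end Hierarchy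

/-! ### The p-values of a single split -/

section Split

variable {n p : ℕ}

/-- The adjusted p-value of the cluster `D` from the observations in `Iᶜ` and the screened set `S`,
as a function of the standardized noise `z`; it is replaced by `1` if screening has failed. -/
def screenedPValue (X : Matrix (Fin n) (Fin p) ℝ) (β : Fin p → ℝ) (σ : ℝ) (I : Finset (Fin n))
    (S D : Finset (Fin p)) (z : EuclideanSpace ℝ (Fin n)) : ℝ :=
  if activeSet β ⊆ S then adjPValue X Iᶜ S D (response X β (σ • z)) else 1

variable {X : Matrix (Fin n) (Fin p) ℝ} {β : Fin p → ℝ} {σ : ℝ} {I : Finset (Fin n)}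
  {S D : Finset (Fin p)}

theorem measurable_screenedPValue (hD : NullHypothesis β D) (hσ : σ ≠ 0) :
    Measurable (screenedPValue X β σ I S D) := by
  unfold screenedPValue adjPValue clusterPValue
  split_ifs with hS hne
  · simp only [partialFPValue_response hS hD hσ]
    exact ((measurable_noisePValue.comp (measurable_restrictTo Iᶜ)).mul_const _).min
      measurable_const
  · exact measurable_const
  · exact measurable_const

theorem noisePValue_le_of_screenedPValue_le (hD : NullHypothesis β D) (hσ : σ ≠ 0) {t : ℝ}
    (ht : t < 1) {z : EuclideanSpace ℝ (Fin n)} (h : screenedPValue X β σ I S D z ≤ t) :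
    noisePValue X Iᶜ S D (restrictTo Iᶜ z) ≤ t * (((D ∩ S).card : ℝ) / S.card) := by
  unfold screenedPValue adjPValue clusterPValue at h
  split_ifs at h with hS hne
  · rw [partialFPValue_response hS hD hσ] at h
    have h1 := (min_le_iff.1 h).resolve_right ht.not_ge
    have hDS : (0 : ℝ) < (D ∩ S).card := by exact_mod_cast hne.card_pos
    have hS0 : (0 : ℝ) < S.card := hDS.trans_le
      (by exact_mod_cast Finset.card_le_card Finset.inter_subset_right)
    rw [← mul_div_assoc, div_le_iff₀ hDS] at h1
    rwa [← mul_div_assoc, le_div_iff₀ hS0]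
  · linarith
  · linarith

variable {Ω U : Type*} [MeasurableSpace Ω] [MeasurableSpace U] {μ : Measure Ω}
  [IsProbabilityMeasure μ] {Z : Ω → EuclideanSpace ℝ (Fin n)} {N : Ω → Finset (Fin n)} {ξ : Ω → U}

/-- Sample splitting: an event that depends on the split, the seed and the noise in the screening
half `I` is independent of the noise in the other half. -/
theorem measure_inter_restrictTo_compl {V : Type*} [MeasurableSpace V] {v : Ω → V}
    (hv : Measurable v) (hZ : Measurable Z)
    (hlaw : μ.map Z = stdGaussian (EuclideanSpace ℝ (Fin n))) (hind : IndepFun v Z μ)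
    {P : Set (V × EuclideanSpace ℝ I)} (hP : MeasurableSet P)
    {Q : Set (EuclideanSpace ℝ (Iᶜ : Finset (Fin n)))} (hQ : MeasurableSet Q) :
    μ ({ω | (v ω, restrictTo I (Z ω)) ∈ P} ∩ {ω | restrictTo Iᶜ (Z ω) ∈ Q}) =
      μ {ω | (v ω, restrictTo I (Z ω)) ∈ P} *
        stdGaussian (EuclideanSpace ℝ (Iᶜ : Finset (Fin n))) Q := by
  have hI := measurable_restrictTo I
  have hJ := measurable_restrictTo Iᶜ
  have : IsProbabilityMeasure (μ.map v) := Measure.isProbabilityMeasure_map hv.aemeasurable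
  have h1 : μ.map (fun ω => (v ω, Z ω)) = (μ.map v).prod (stdGaussian _) := by
    rw [← hlaw]
    exact hind.map_prod_eq_prod_map_map hv.aemeasurable hZ.aemeasurable
  have h2 : μ.map (fun ω => ((v ω, restrictTo I (Z ω)), restrictTo Iᶜ (Z ω))) =
      ((μ.map v).prod (stdGaussian (EuclideanSpace ℝ I))).prod
        (stdGaussian (EuclideanSpace ℝ (Iᶜ : Finset (Fin n)))) := by
    apply MeasurableEquiv.prodAssoc.map_measurableEquiv_injective
    rw [Measure.prodAssoc_prod, ← map_restrictTo_stdGaussian I]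
    rw [← Measure.map_id (μ := μ.map v)]
    rw [Measure.map_prod_map _ _ measurable_id (hI.prodMk hJ), ← h1,
      Measure.map_map (by fun_prop) (by fun_prop), Measure.map_map (by fun_prop) (by fun_prop)]
    rfl
  have h3 : Measurable fun ω => ((v ω, restrictTo I (Z ω)), restrictTo Iᶜ (Z ω)) := by fun_prop
  have h4 := congrArg (fun m => m (P ×ˢ Q)) h2
  have h5 := congrArg (fun m => m (P ×ˢ Set.univ)) h2
  simp only [Measure.prod_prod, measure_univ, mul_one] at h4 h5
  rw [Measure.map_apply h3 (hP.prod hQ)] at h4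
  rw [Measure.map_apply h3 (hP.prod .univ)] at h5
  have h6 : {ω | (v ω, restrictTo I (Z ω)) ∈ P} =
      (fun ω => ((v ω, restrictTo I (Z ω)), restrictTo Iᶜ (Z ω))) ⁻¹' (P ×ˢ Set.univ) := by
    ext ω
    simp
  rw [← h6] at h5
  rw [h5, ← h4]
  rfl

theorem measurable_selected (A : Screening n p U) (I : Finset (Fin n)) :
    Measurable fun q : U × (Fin n → ℝ) => A.selected I q.1 q.2 :=
  (A.measurable_select I).comp
    (measurable_fst.prodMk (measurable_pi_lambda _ fun _ => (measurable_pi_apply _).comp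
      measurable_snd))

theorem measurable_selected_comp (A : Screening n p U) {Y : Ω → Fin n → ℝ} (hN : Measurable N)
    (hξ : Measurable ξ) (hY : Measurable Y) :
    Measurable fun ω => A.selected (N ω) (ξ ω) (Y ω) := by
  have h : Measurable fun q : Finset (Fin n) × (U × (Fin n → ℝ)) => A.selected q.1 q.2.1 q.2.2 :=
    measurable_from_prod_countable_right fun I => measurable_selected A I
  exact h.comp (hN.prodMk (hξ.prodMk hY))

theorem measurable_response (X : Matrix (Fin n) (Fin p) ℝ) (β : Fin p → ℝ) :
    Measurable (response X β) := by
  unfold response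
  fun_prop

/-- For a single split, the adjusted p-values of the maximal null clusters satisfy a Bonferroni
type inequality. -/
theorem sum_measure_screenedPValue_le {T : Hierarchy p} {A : Screening n p U} (hσ : σ ≠ 0)
    (hN : Measurable N) (hξ : Measurable ξ) (hZ : Measurable Z)
    (hlaw : μ.map Z = stdGaussian (EuclideanSpace ℝ (Fin n)))
    (hind : IndepFun (fun ω => (N ω, ξ ω)) Z μ) {Y : Ω → Fin n → ℝ}
    (hY : ∀ ω, Y ω = response X β (σ • Z ω))
    (hrank : ∀ᵐ ω ∂μ, LinearIndependent ℝ
      fun (j : (A.selected (N ω) (ξ ω) (Y ω) : Finset (Fin p)))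
        (i : ((N ω)ᶜ : Finset (Fin n))) => X i j)
    {t : ℝ} (ht0 : 0 < t) (ht : t < 1) :
    ∑ D ∈ T.maximalNull β,
      μ {ω | screenedPValue X β σ (N ω) (A.selected (N ω) (ξ ω) (Y ω)) D (Z ω) ≤ t} ≤
      ENNReal.ofReal t := by
  let W : Ω → Finset (Fin n) × Finset (Fin p) := fun ω => (N ω, A.selected (N ω) (ξ ω) (Y ω))
  have hYm : Measurable Y := by
    rw [funext hY]
    exact (measurable_response X β).comp (hZ.const_smul σ)
  have hW : Measurable W := hN.prodMk (measurable_selected_comp A hN hξ hYm)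
  -- conditionally on the split and on the screened set, the p-value is valid
  have hcell : ∀ D ∈ T.maximalNull β, ∀ q : Finset (Fin n) × Finset (Fin p),
      μ (W ⁻¹' {q} ∩ {ω | screenedPValue X β σ q.1 q.2 D (Z ω) ≤ t}) ≤
        μ (W ⁻¹' {q}) * ENNReal.ofReal (t * (((D ∩ q.2).card : ℝ) / q.2.card)) := by
    rintro D hD ⟨I, S⟩
    have hDnull : NullHypothesis β D := (Hierarchy.mem_maximalNull.1 hD).prop.2
    rcases eq_or_ne (μ (W ⁻¹' {(I, S)})) 0 with h0 | h0
    · exact (measure_mono_null Set.inter_subset_left h0).trans_le zero_le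
    have hLI : LinearIndependent ℝ fun (j : S) (i : (Iᶜ : Finset (Fin n))) => X i j := by
      obtain ⟨ω, hω, hr⟩ := ((frequently_ae_mem_iff.2 h0).and_eventually hrank).exists
      obtain ⟨h1, h2⟩ := Prod.mk.inj (Set.mem_singleton_iff.1 hω)
      rw [h2, h1] at hr
      exact hr
    let P : Set ((Finset (Fin n) × U) × EuclideanSpace ℝ I) :=
      {q | q.1.1 = I ∧ A.select I q.1.2 (fun i => (X.mulVec β) i + σ * q.2 i) = S}
    have hP : MeasurableSet P := by
      have hdata : Measurable fun q : (Finset (Fin n) × U) × EuclideanSpace ℝ I =>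
          (q.1.2, fun i : I => (X.mulVec β) i + σ * q.2 i) := by fun_prop
      exact (measurableSet_eq_fun (by fun_prop) measurable_const).inter
        (measurableSet_eq_fun ((A.measurable_select I).comp hdata) measurable_const)
    have hWP : W ⁻¹' {(I, S)} = {ω | ((N ω, ξ ω), restrictTo I (Z ω)) ∈ P} := by
      ext ω
      simp only [W, P, Set.mem_preimage, Set.mem_singleton_iff, Prod.mk.injEq, Set.mem_ofPred_eq]
      refine and_congr_right fun hI => ?_
      rw [hI, hY]
      rfl
    have hQ : MeasurableSet {w : EuclideanSpace ℝ (Iᶜ : Finset (Fin n)) |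
        noisePValue X Iᶜ S D w ≤ t * (((D ∩ S).card : ℝ) / S.card)} :=
      measurable_noisePValue measurableSet_Iic
    calc μ (W ⁻¹' {(I, S)} ∩ {ω | screenedPValue X β σ I S D (Z ω) ≤ t})
        ≤ μ ({ω | ((N ω, ξ ω), restrictTo I (Z ω)) ∈ P} ∩ {ω | restrictTo Iᶜ (Z ω) ∈
            {w | noisePValue X Iᶜ S D w ≤ t * (((D ∩ S).card : ℝ) / S.card)}}) := by
          rw [hWP]
          exact measure_mono (Set.inter_subset_inter_right _ fun ω hω =>
            noisePValue_le_of_screenedPValue_le hDnull hσ ht hω)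
      _ ≤ _ := by
          rw [measure_inter_restrictTo_compl (hN.prodMk hξ) hZ hlaw hind hP hQ, hWP]
          exact mul_le_mul_right (stdGaussian_noisePValue_le hLI _) _
  calc ∑ D ∈ T.maximalNull β, μ {ω | screenedPValue X β σ (W ω).1 (W ω).2 D (Z ω) ≤ t}
      ≤ ∑ D ∈ T.maximalNull β, ∑ q,
          μ (W ⁻¹' {q}) * ENNReal.ofReal (t * (((D ∩ q.2).card : ℝ) / q.2.card)) := by
        refine Finset.sum_le_sum fun D hD => ?_
        refine le_trans ?_ (Finset.sum_le_sum fun q _ => hcell D hD q)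
        refine le_trans (measure_mono fun ω hω => ?_) (measure_biUnion_finset_le _ _)
        exact Set.mem_biUnion (Finset.mem_univ (W ω)) ⟨rfl, hω⟩
    _ = ∑ q, μ (W ⁻¹' {q}) * ENNReal.ofReal
          (t * ∑ D ∈ T.maximalNull β, ((D ∩ q.2).card : ℝ) / q.2.card) := by
        rw [Finset.sum_comm]
        refine Finset.sum_congr rfl fun q _ => ?_
        rw [Finset.mul_sum _ _ t, ENNReal.ofReal_sum_of_nonneg, Finset.mul_sum]
        exact fun D _ => by positivity
    _ ≤ ∑ q, μ (W ⁻¹' {q}) * ENNReal.ofReal t := by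
        gcongr with q
        exact mul_le_of_le_one_right ht0.le (Hierarchy.sum_card_inter_div_le q.2)
    _ = ENNReal.ofReal t := by
        rw [← Finset.sum_mul, sum_measure_preimage_singleton _ fun q _ =>
          hW (measurableSet_singleton q)]
        simp

theorem measurable_screenedPValue_comp {A : Screening n p U} (hD : NullHypothesis β D)
    (hσ : σ ≠ 0) (hN : Measurable N) (hξ : Measurable ξ) (hZ : Measurable Z)
    {Y : Ω → Fin n → ℝ} (hY : Measurable Y) :
    Measurable fun ω =>
      screenedPValue X β σ (N ω) (A.selected (N ω) (ξ ω) (Y ω)) D (Z ω) := by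
  have h : Measurable fun q : (Finset (Fin n) × Finset (Fin p)) × EuclideanSpace ℝ (Fin n) =>
      screenedPValue X β σ q.1.1 q.1.2 D q.2 :=
    measurable_from_prod_countable_right fun q =>
      measurable_screenedPValue (I := q.1) (S := q.2) hD hσ
  exact h.comp ((hN.prodMk (measurable_selected_comp A hN hξ hY)).prodMk hZ)

end Split

/-! ### Simultaneous screening -/

/-- Given the noise, the events of the splits are independent with the same probability `g`; so
they hold simultaneously with probability `E[g ^ B] ≥ (E g) ^ B`, by Jensen's inequality. -/
theorem pow_le_measureReal_forall {Ω V E : Type*} [MeasurableSpace Ω] [MeasurableSpace V]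
    [MeasurableSpace E] {μ : Measure Ω} [IsProbabilityMeasure μ] {B : ℕ} (b₀ : Fin B)
    {v : Fin B → Ω → V} {e : Ω → E} (hv : ∀ b, Measurable (v b)) (he : Measurable e)
    (hindep : iIndepFun v μ) (hident : ∀ b, IdentDistrib (v b) (v b₀) μ μ)
    (hnoise : IndepFun (fun ω b => v b ω) e μ) {G : Set (V × E)} (hG : MeasurableSet G) :
    μ.real {ω | (v b₀ ω, e ω) ∈ G} ^ B ≤ μ.real {ω | ∀ b, (v b ω, e ω) ∈ G} := by
  set ρ := μ.map (v b₀) with hρ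
  set ν := μ.map e with hν
  have : IsProbabilityMeasure ρ := Measure.isProbabilityMeasure_map (hv b₀).aemeasurable
  have : IsProbabilityMeasure ν := Measure.isProbabilityMeasure_map he.aemeasurable
  have hvm : Measurable fun ω b => v b ω := measurable_pi_lambda _ hv
  have hpi : μ.map (fun ω b => v b ω) = Measure.pi fun _ => ρ := by
    rw [(iIndepFun_iff_map_fun_eq_pi_map fun b => (hv b).aemeasurable).1 hindep]
    congr 1
    exact funext fun b => (hident b).map_eq
  have hjoint : μ.map (fun ω => ((fun b => v b ω), e ω)) = (Measure.pi fun _ => ρ).prod ν := by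
    rw [hnoise.map_prod_eq_prod_map_map hvm.aemeasurable he.aemeasurable, hpi]
  have hjoint₀ : μ.map (fun ω => (v b₀ ω, e ω)) = ρ.prod ν :=
    (hnoise.comp (measurable_pi_apply b₀) measurable_id).map_prod_eq_prod_map_map
      (hv b₀).aemeasurable he.aemeasurable
  let g : E → ℝ := fun y => ρ.real {w | (w, y) ∈ G}
  have hgm : Measurable g := (measurable_measure_prodMk_right hG).ennreal_toReal
  have hg1 : ∀ y, ‖g y‖ ≤ 1 := fun y => by
    rw [Real.norm_of_nonneg measureReal_nonneg]
    exact measureReal_le_one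
  have h₀ : μ.real {ω | (v b₀ ω, e ω) ∈ G} = ∫ y, g y ∂ν := by
    have h1 : μ.real {ω | (v b₀ ω, e ω) ∈ G} = (ρ.prod ν).real G := by
      rw [← hjoint₀, map_measureReal_apply ((hv b₀).prodMk he) hG]
      rfl
    rw [h1, measureReal_def, Measure.prod_apply_symm hG,
      integral_eq_lintegral_of_nonneg_ae (.of_forall fun y => measureReal_nonneg)
        hgm.aestronglyMeasurable]
    congr 1
    exact lintegral_congr fun y => (ofReal_measureReal (μ := ρ)).symm
  have hB : μ.real {ω | ∀ b, (v b ω, e ω) ∈ G} = ∫ y, g y ^ B ∂ν := by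
    have hGB : MeasurableSet {q : (Fin B → V) × E | ∀ b, (q.1 b, q.2) ∈ G} := by
      simp only [Set.ofPred_forall]
      exact MeasurableSet.iInter fun b =>
        (((measurable_pi_apply b).comp measurable_fst).prodMk measurable_snd) hG
    have h1 : μ.real {ω | ∀ b, (v b ω, e ω) ∈ G} =
        ((Measure.pi fun _ => ρ).prod ν).real {q : (Fin B → V) × E | ∀ b, (q.1 b, q.2) ∈ G} := by
      rw [← hjoint, map_measureReal_apply (hvm.prodMk he) hGB]
      rfl
    rw [h1, measureReal_def, Measure.prod_apply_symm hGB,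
      integral_eq_lintegral_of_nonneg_ae
        (.of_forall fun y => pow_nonneg measureReal_nonneg B)
        (hgm.pow_const B).aestronglyMeasurable]
    congr 1
    refine lintegral_congr fun y => ?_
    have h2 : (fun x : Fin B → V => (x, y)) ⁻¹' {q : (Fin B → V) × E | ∀ b, (q.1 b, q.2) ∈ G} =
        Set.univ.pi fun _ => {w | (w, y) ∈ G} := by
      ext x
      simp
    rw [h2, Measure.pi_pi, Finset.prod_const, Finset.card_univ, Fintype.card_fin,
      ENNReal.ofReal_pow measureReal_nonneg, ofReal_measureReal]
  rw [h₀, hB]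
  have hint : Integrable g ν := Integrable.of_bound hgm.aestronglyMeasurable 1 (.of_forall hg1)
  have hintB : Integrable (fun y => g y ^ B) ν :=
    Integrable.of_bound (hgm.pow_const B).aestronglyMeasurable 1 (.of_forall fun y => by
      rw [norm_pow]
      exact pow_le_one₀ (norm_nonneg _) (hg1 y))
  exact (convexOn_pow B).map_integral_le (continuous_pow B).continuousOn isClosed_Ici
    (.of_forall fun y => Set.mem_Ici.2 measureReal_nonneg) hint hintB

/-! ### Control of the familywise error rate -/

/-- If all screened sets contain the active set, a false rejection at level `α` is a rejection of a
maximal null cluster by the p-values `screenedPValue`, whatever the aggregation `agg` is. -/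
theorem measureReal_falseRejection_le {Ω U : Type*} [MeasurableSpace Ω] [MeasurableSpace U]
    {μ : Measure Ω} [IsProbabilityMeasure μ] {n p B : ℕ} {X : Matrix (Fin n) (Fin p) ℝ}
    {β : Fin p → ℝ} {σ : ℝ} {Z : Ω → EuclideanSpace ℝ (Fin n)} {Y : Ω → Fin n → ℝ}
    (hY : ∀ ω, Y ω = response X β (σ • Z ω)) {T : Hierarchy p} {A : Screening n p U}
    {N : Fin B → Ω → Finset (Fin n)} {ξ : Fin B → Ω → U} {c α : ℝ}
    (hscreenm : MeasurableSet {ω | ∀ b, activeSet β ⊆ A.selected (N b ω) (ξ b ω) (Y ω)})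
    (hscreen : c ≤ μ.real {ω | ∀ b, activeSet β ⊆ A.selected (N b ω) (ξ b ω) (Y ω)})
    (agg : (Fin B → ℝ) → ℝ)
    (hagg : μ.real {ω | ∃ D ∈ T.maximalNull β, agg (fun b =>
      screenedPValue X β σ (N b ω) (A.selected (N b ω) (ξ b ω) (Y ω)) D (Z ω)) ≤ α} ≤ α) :
    μ.real {ω | (T.rejected (T.adjust fun D => agg (splitPValues X A (fun b => N b ω)
      (fun b => ξ b ω) (Y ω) D)) α ∩ T.nullClusters β).Nonempty} ≤ α + 1 - c := by
  set s := {ω | ∀ b, activeSet β ⊆ A.selected (N b ω) (ξ b ω) (Y ω)} with hs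
  calc _ ≤ μ.real ({ω | ∃ D ∈ T.maximalNull β, agg (fun b => screenedPValue X β σ (N b ω)
            (A.selected (N b ω) (ξ b ω) (Y ω)) D (Z ω)) ≤ α} ∪ sᶜ) := by
        refine measureReal_mono fun ω hω => ?_
        by_cases hωs : ω ∈ s
        · left
          obtain ⟨D, hD, hle⟩ := Hierarchy.exists_maximalNull_le hω
          refine ⟨D, hD, ?_⟩
          convert hle using 2
          funext b
          rw [screenedPValue, if_pos (hωs b), splitPValues, hY]
        · exact Or.inr hωs
    _ ≤ α + μ.real sᶜ := (measureReal_union_le _ _).trans (by gcongr)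
    _ ≤ α + 1 - c := by
        rw [probReal_compl_eq_one_sub hscreenm]
        linarith

/-- Error control for every aggregation `agg` that turns a Bonferroni type inequality for the
p-values of each split into one for the aggregated p-values. The noise is represented as `σ • Z`
with a standard Gaussian vector `Z`. -/
theorem measureReal_rejected_inter_nullClusters_le {Ω U : Type*} [MeasurableSpace Ω]
    [MeasurableSpace U] {μ : Measure Ω} [IsProbabilityMeasure μ] {n p B : ℕ} (hB : 0 < B)
    {X : Matrix (Fin n) (Fin p) ℝ} {β : Fin p → ℝ} {σ : ℝ} (hσ : σ ≠ 0)
    {Z : Ω → EuclideanSpace ℝ (Fin n)} (hZ : Measurable Z)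
    (hlaw : μ.map Z = stdGaussian (EuclideanSpace ℝ (Fin n)))
    {Y : Ω → Fin n → ℝ} (hY : ∀ ω, Y ω = response X β (σ • Z ω))
    {T : Hierarchy p} {A : Screening n p U} {N : Fin B → Ω → Finset (Fin n)} {ξ : Fin B → Ω → U}
    (hN : ∀ b, Measurable (N b)) (hξ : ∀ b, Measurable (ξ b))
    (hindep : iIndepFun (fun b ω => (N b ω, ξ b ω)) μ)
    (hident : ∀ b b', IdentDistrib (fun ω => (N b ω, ξ b ω)) (fun ω => (N b' ω, ξ b' ω)) μ μ)
    (hnoise : IndepFun (fun ω b => (N b ω, ξ b ω)) Z μ)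
    (hrank : ∀ b, ∀ᵐ ω ∂μ, LinearIndependent ℝ
      fun (j : (A.selected (N b ω) (ξ b ω) (Y ω) : Finset (Fin p)))
        (i : ((N b ω)ᶜ : Finset (Fin n))) => X i j)
    {δ : ℝ} (hδ : δ ≤ 1)
    (hscreen : ∀ b, 1 - δ ≤ μ.real {ω | activeSet β ⊆ A.selected (N b ω) (ξ b ω) (Y ω)})
    {α : ℝ} (agg : (Fin B → ℝ) → ℝ)
    (hagg : ∀ (M : Finset (Finset (Fin p))) (x : Finset (Fin p) → Fin B → Ω → ℝ),
      (∀ D ∈ M, ∀ b, Measurable (x D b)) →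
      (∀ b, ∀ t : ℝ, 0 < t → t < 1 → ∑ D ∈ M, μ {ω | x D b ω ≤ t} ≤ ENNReal.ofReal t) →
      μ.real {ω | ∃ D ∈ M, agg (fun b => x D b ω) ≤ α} ≤ α) :
    μ.real {ω | (T.rejected (T.adjust fun D => agg (splitPValues X A (fun b => N b ω)
      (fun b => ξ b ω) (Y ω) D)) α ∩ T.nullClusters β).Nonempty} ≤ α + 1 - (1 - δ) ^ B := by
  have hYm : Measurable Y := by
    rw [funext hY]
    exact (measurable_response X β).comp (hZ.const_smul σ)
  let G : Set ((Finset (Fin n) × U) × EuclideanSpace ℝ (Fin n)) :=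
    {q | activeSet β ⊆ A.selected q.1.1 q.1.2 (response X β (σ • q.2))}
  have hG : MeasurableSet G :=
    measurable_selected_comp A (measurable_fst.comp measurable_fst)
      (measurable_snd.comp measurable_fst)
      ((measurable_response X β).comp (measurable_snd.const_smul σ))
      (MeasurableSet.of_discrete (s := {S | activeSet β ⊆ S}))
  have hpair : ∀ b, Measurable fun ω => (N b ω, ξ b ω) := fun b => (hN b).prodMk (hξ b)
  have hall := pow_le_measureReal_forall (μ := μ) ⟨0, hB⟩ hpair hZ hindep
    (fun b => hident b _) hnoise hG
  have hev : ∀ b ω, activeSet β ⊆ A.selected (N b ω) (ξ b ω) (Y ω) ↔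
      ((N b ω, ξ b ω), Z ω) ∈ G := fun b ω => by rw [hY]; rfl
  simp only [hev] at hscreen
  refine measureReal_falseRejection_le hY ?_ ?_ agg (hagg _ (fun D b ω =>
    screenedPValue X β σ (N b ω) (A.selected (N b ω) (ξ b ω) (Y ω)) D (Z ω)) ?_ ?_)
  · simp only [hev, Set.ofPred_forall]
    exact MeasurableSet.iInter fun b => ((hpair b).prodMk hZ) hG
  · simp only [hev]
    exact (pow_le_pow_left₀ (sub_nonneg.2 hδ) (hscreen _) B).trans hall
  · exact fun D hD b => measurable_screenedPValue_comp
      (Hierarchy.mem_maximalNull.1 hD).prop.2 hσ (hN b) (hξ b) hZ hYm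
  · exact fun b t ht0 ht1 => sum_measure_screenedPValue_le hσ (hN b) (hξ b) hZ hlaw
      (hnoise.comp (measurable_pi_apply b) measurable_id) hY (hrank b) ht0 ht1

end HierTest

end

theorem theorem1 {Ω U : Type*} [MeasurableSpace Ω] [MeasurableSpace U]
    (μ : Measure Ω) [IsProbabilityMeasure μ]
    {n p B : ℕ} (hB : 0 < B)
    -- the linear model with fixed design and Gaussian noise
    (X : Matrix (Fin n) (Fin p) ℝ) (β : Fin p → ℝ) (σ : ℝ) (hσ : 0 < σ)
    (ε : Ω → EuclideanSpace ℝ (Fin n))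
    (hε : HasLaw ε (multivariateGaussian 0 (σ ^ 2 • (1 : Matrix (Fin n) (Fin n) ℝ))) μ)
    (Y : Ω → Fin n → ℝ) (hY : ∀ ω, Y ω = HierTest.response X β (ε ω))
    -- the hierarchy and the screening procedure
    (T : HierTest.Hierarchy p) (A : HierTest.Screening n p U)
    -- the `B` random splits (screening half `N b`) with the seeds of the screening procedure:
    -- independent and identically distributed, and independent of the noise
    (N : Fin B → Ω → Finset (Fin n)) (ξ : Fin B → Ω → U)
    (hN : ∀ b, Measurable (N b)) (hξ : ∀ b, Measurable (ξ b))
    (hcard : ∀ b, ∀ᵐ ω ∂μ, (N b ω).card = n / 2)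
    (hindep : iIndepFun (fun b ω => (N b ω, ξ b ω)) μ)
    (hident : ∀ b b', IdentDistrib (fun ω => (N b ω, ξ b ω)) (fun ω => (N b' ω, ξ b' ω)) μ μ)
    (hnoise : IndepFun (fun ω b => (N b ω, ξ b ω)) ε μ)
    -- full rank of the design of the partial F-tests
    (hrank : ∀ b, ∀ᵐ ω ∂μ, LinearIndependent ℝ
      fun (j : (A.selected (N b ω) (ξ b ω) (Y ω) : Finset (Fin p)))
        (i : ((N b ω)ᶜ : Finset (Fin n))) => X i j)
    -- sparsity property
    (hA1 : ∀ b, ∀ᵐ ω ∂μ, ((A.selected (N b ω) (ξ b ω) (Y ω)).card : ℝ) < (n : ℝ) / 2)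
    -- `δ`-screening property
    (δ : ℝ) (hδ0 : 0 < δ) (hδ1 : δ < 1)
    (hA2 : ∀ b, 1 - δ ≤
      μ.real {ω | HierTest.activeSet β ⊆ A.selected (N b ω) (ξ b ω) (Y ω)})
    (α : ℝ) (hα0 : 0 < α) (hα1 : α < 1) :
    (∀ γ : ℝ, 0 < γ → γ < 1 →
      μ.real {ω | (T.rejected (HierTest.Qh X T A γ (fun b => N b ω) (fun b => ξ b ω) (Y ω)) α ∩
          T.nullClusters β).Nonempty} ≤ α + 1 - (1 - δ) ^ B) ∧
    (∀ γmin : ℝ, 0 < γmin → γmin < 1 →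
      μ.real {ω | (T.rejected (HierTest.Ph X T A γmin (fun b => N b ω) (fun b => ξ b ω) (Y ω)) α ∩
          T.nullClusters β).Nonempty} ≤ α + 1 - (1 - δ) ^ B) ∧
    α + 1 - (1 - δ) ^ B ≤ α + B * δ := by
  -- `ε` is only almost everywhere measurable, and is replaced by a measurable version `σ • Z`
  obtain ⟨ε', hε'm, hε'⟩ := hε.aemeasurable
  let Z : Ω → EuclideanSpace ℝ (Fin n) := fun ω => σ⁻¹ • ε' ω
  let Y' : Ω → Fin n → ℝ := fun ω => HierTest.response X β (σ • Z ω)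
  have hZ : Measurable Z := hε'm.const_smul σ⁻¹
  have hYY' : ∀ᵐ ω ∂μ, Y ω = Y' ω := by
    filter_upwards [hε'] with ω hω
    simp only [Y', Z, smul_inv_smul₀ hσ.ne', hY, hω]
  have hlaw : μ.map Z = stdGaussian (EuclideanSpace ℝ (Fin n)) := by
    have h1 : μ.map Z = (μ.map ε').map (fun z => σ⁻¹ • z) :=
      (Measure.map_map (by fun_prop) hε'm).symm
    rw [h1, ← Measure.map_congr hε', hε.map_eq, HierTest.multivariateGaussian_zero_sq_smul_one,
      Measure.map_map (by fun_prop) (by fun_prop)]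
    simp [Function.comp_def, inv_smul_smul₀ hσ.ne']
  have hnoise' : IndepFun (fun ω b => (N b ω, ξ b ω)) Z μ :=
    (hnoise.congr .rfl hε').comp measurable_id (measurable_const_smul σ⁻¹)
  have hrank' : ∀ b, ∀ᵐ ω ∂μ, LinearIndependent ℝ
      fun (j : (A.selected (N b ω) (ξ b ω) (Y' ω) : Finset (Fin p)))
        (i : ((N b ω)ᶜ : Finset (Fin n))) => X i j := fun b => by
    filter_upwards [hrank b, hYY'] with ω h1 h2
    rwa [← h2]
  have hA2' : ∀ b, 1 - δ ≤
      μ.real {ω | HierTest.activeSet β ⊆ A.selected (N b ω) (ξ b ω) (Y' ω)} := fun b => by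
    refine (hA2 b).trans_eq (measureReal_congr (Filter.eventuallyEq_set.2 ?_))
    filter_upwards [hYY'] with ω h
    simp only [h]
  refine ⟨fun γ hγ0 hγ1 => ?_, fun γmin hγ0 hγ1 => ?_, ?_⟩
  · refine le_of_eq_of_le (measureReal_congr (Filter.eventuallyEq_set.2 ?_))
      (HierTest.measureReal_rejected_inter_nullClusters_le hB hσ.ne' hZ hlaw (Y := Y')
        (fun _ => rfl) (T := T) (A := A) hN hξ hindep hident hnoise' hrank' hδ1.le hA2'
        (HierTest.aggregate γ) fun M x hx hsum =>
          HierTest.measureReal_exists_aggregate_le hB hx hsum hγ0 hγ1 hα0)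
    filter_upwards [hYY'] with ω h
    simp only [HierTest.Qh, h]
  · refine le_of_eq_of_le (measureReal_congr (Filter.eventuallyEq_set.2 ?_))
      (HierTest.measureReal_rejected_inter_nullClusters_le hB hσ.ne' hZ hlaw (Y := Y')
        (fun _ => rfl) (T := T) (A := A) hN hξ hindep hident hnoise' hrank' hδ1.le hA2'
        (HierTest.aggregateInf γmin) fun M x hx hsum =>
          HierTest.measureReal_exists_aggregateInf_le hB hx hsum hγ0 hγ1 hα0)
    filter_upwards [hYY'] with ω h
    simp only [HierTest.Ph, h]
  · have := one_add_mul_le_pow (a := -δ) (by linarith) B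
    rw [← sub_eq_add_neg] at this
    linarith
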